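/- All graphs are finite, simple and undirected. For a connected graph $H$ with at least two vertices, Kemeny's constant of $H$ is $\kappa(H)=\sum_{j\neq i} m_{i,j}w_j$, where $m_{i,j}$ is the mean first passage time from $i$ to $j$ of the simple random walk on $H$ (transition probability $1/\deg_H(x)$ from $x$ to each of its neighbours) and $w$ is its stationary distribution; this is a finite number that does not depend on the vertex $i$. Let $G$ be a connected graph, $v\in V(G)$, and let $k_1,k_2\ge 0$ be integers with $k_1+k_2\ge 2$; put $k=k_1+k_2+1$. Let $\widetilde G$ be the graph obtained from $G$ and two disjoint paths $(v_1,\dots,v_{k_1+1})$ and $(w_1,\dots,w_{k_2+1})$ by identifying $v$, $v_1$ and $w_1$, and let $\widehat G$ be obtained from $\widetilde G$ by adding the edge between $v_{k_1+1}$ and $w_{k_2+1}$ (the end of a path with $k_i=0$ being $v$ itself). $G$ is called $(v,k_1,k_2)$-paradoxical if $\kappa(\widehat G)>\kappa(\widetilde G)$. Let $m$ be the number of edges and $\tau$ the number of spanning trees of $G$, let $\mathbf d$ be its vector of vertex degrees, let $\mathbf 1$ be the all-ones column vector, let $F=[f_{i,j}]$ be the matrix in which $f_{i,j}$ is the number of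 spanning forests of $G$ consisting of exactly two trees, one containing $i$ and the other containing $j$ (so $f_{i,i}=0$), and let $\mathbf f^v$ be the $v$-th column of $F$. Put $$\phi_G(v)=\mathbf d^T\left(2\mathbf f^v\mathbf 1^T-F\right)\mathbf d,$$ $$\phi_1=-\tfrac23(k_1+k_2)(k_1+k_2-1)+2k_1k_2,$$ $$\phi_2=-(k_1+k_2)\left(5(k_1+k_2)^2-(k_1+k_2)-1\right)+12k_1k_2(k_1+k_2+1),$$ $$\phi_3=-(k_1+k_2+1)(k_1+k_2)(k_1+k_2-1)^2,$$ $$\Phi_G(v,k_1,k_2)=k\,\phi_G(v)+4m^2\tau k\,\phi_1+\frac{2m\tau k}{3}\phi_2+\frac{2\tau k}{3}\phi_3 .$$ Theorem. Kemeny's constants of $\widetilde G$ and $\widehat G$ are well defined, and $G$ is $(v,k_1,k_2)$-paradoxical if and only if $\Phi_G(v,k_1,k_2)>0$. -/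

import Mathlib

open scoped NNReal ENNReal

/-! ### Markov chains, mean first passage times and Kemeny's constant -/

/-- `tailProb M j t i` is the probability `ℙ_i(T_j > t)`, where `T_j = min {s ≥ 1 : X_s = j}` is the
first passage time to `j` of the Markov chain with transition matrix `M` started at `i`: the first
`t` steps all lead to states other than `j`. -/
noncomputable def tailProb {V : Type*} [Fintype V] (M : Matrix V V ℝ) (j : V) : ℕ → V → ℝ
  | 0, _ => 1
  | t + 1, i => open Classical in ∑ x with x ≠ j, M i x * tailProb M j t x

/-- The mean first passage time `m_{i,j} = 𝔼_i[T_j] = ∑_{t ≥ 0} ℙ_i(T_j > t)`, in `[0, ∞]`. -/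
noncomputable def meanFirstPassageTime {V : Type*} [Fintype V] (M : Matrix V V ℝ) (i j : V) :
    ℝ≥0∞ :=
  ∑' t : ℕ, ENNReal.ofReal (tailProb M j t i)

/-- `w` is a stationary (probability) distribution of the chain with transition matrix `M`. -/
structure IsStationaryDistribution {V : Type*} [Fintype V] (M : Matrix V V ℝ) (w : V → ℝ) :
    Prop where
  nonneg : ∀ i, 0 ≤ w i
  sum_eq_one : ∑ i, w i = 1
  vecMul_eq : Matrix.vecMul w M = w

/-- `κ` is Kemeny's constant of the chain with transition matrix `M`: the chain has exactly one
stationary distribution `w`, and `∑_{j ≠ i} m_{i,j} w_j = κ` for every initial state `i`. -/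
def IsKemenyConstant {V : Type*} [Fintype V] (M : Matrix V V ℝ) (κ : ℝ≥0) : Prop :=
  open Classical in
  (∃! w : V → ℝ, IsStationaryDistribution M w) ∧
    ∀ w : V → ℝ, IsStationaryDistribution M w → ∀ i : V,
      ∑ j with j ≠ i, meanFirstPassageTime M i j * ENNReal.ofReal (w j) = (κ : ℝ≥0∞)

/-! ### Graph parameters -/

namespace SimpleGraph

/-- The degree vector `𝐝_G`. -/
noncomputable def degVec {V : Type*} [Fintype V] (G : SimpleGraph V) (i : V) : ℝ :=
  open Classical in (G.degree i : ℝ)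

/-- The number `m_G` of edges. -/
noncomputable def numEdges {V : Type*} (G : SimpleGraph V) : ℕ := G.edgeSet.ncard

/-- The number `τ_G` of spanning trees; a spanning subgraph is given by its edges, that is, by a
graph on the same vertex set contained in `G`. -/
noncomputable def numSpanningTrees {V : Type*} (G : SimpleGraph V) : ℕ :=
  {T : SimpleGraph V | T ≤ G ∧ T.IsTree}.ncard

/-- The matrix `F_G`: its `(i, j)` entry is the number of spanning forests of `G` that consist of
exactly two trees, one containing `i` and the other containing `j`. -/
noncomputable def twoForestMatrix {V : Type*} (G : SimpleGraph V) : Matrix V V ℝ :=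
  fun i j => ({T : SimpleGraph V | T ≤ G ∧ T.IsAcyclic ∧ Nat.card T.ConnectedComponent = 2 ∧
    ¬ T.Reachable i j}.ncard : ℝ)

/-- The transition matrix of the random walk on `G`. -/
noncomputable def randomWalkMatrix {V : Type*} [Fintype V] (G : SimpleGraph V) : Matrix V V ℝ :=
  open Classical in fun i j => if G.Adj i j then 1 / G.degVec i else 0

/-! ### Twin pendent paths -/

/-- The vertices, in order, of the first path `(v, v₂, …, v_{k₁+1})`, inside the disjoint union of
`V` with the `k₁` new vertices of the first path and the `k₂` new vertices of the second path. -/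
def firstPath {V : Type*} (v : V) (k₁ k₂ : ℕ) : Fin (k₁ + 1) ↪ V ⊕ (Fin k₁ ⊕ Fin k₂) where
  toFun := Fin.cons (Sum.inl v) fun i => Sum.inr (Sum.inl i)
  inj' := by
    rw [Fin.cons_injective_iff]
    refine ⟨by simp, fun a b h => by simpa using h⟩

/-- The vertices, in order, of the second path `(v, w₂, …, w_{k₂+1})`. -/
def secondPath {V : Type*} (v : V) (k₁ k₂ : ℕ) : Fin (k₂ + 1) ↪ V ⊕ (Fin k₁ ⊕ Fin k₂) where
  toFun := Fin.cons (Sum.inl v) fun i => Sum.inr (Sum.inr i)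
  inj' := by
    rw [Fin.cons_injective_iff]
    refine ⟨by simp, fun a b h => by simpa using h⟩

/-- The graph `G̃(v, k₁, k₂)` obtained from `G` and two paths with `k₁ + 1` and `k₂ + 1` vertices
by identifying `v` with the first vertex of each path. -/
def twinPathGraph {V : Type*} (G : SimpleGraph V) (v : V) (k₁ k₂ : ℕ) :
    SimpleGraph (V ⊕ (Fin k₁ ⊕ Fin k₂)) :=
  G.map Function.Embedding.inl ⊔ (pathGraph (k₁ + 1)).map (firstPath v k₁ k₂) ⊔
    (pathGraph (k₂ + 1)).map (secondPath v k₁ k₂)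

/-- The graph `Ĝ(v, k₁, k₂)` obtained from `G̃(v, k₁, k₂)` by inserting the edge between the last
vertices of the two paths. -/
def closedTwinPathGraph {V : Type*} (G : SimpleGraph V) (v : V) (k₁ k₂ : ℕ) :
    SimpleGraph (V ⊕ (Fin k₁ ⊕ Fin k₂)) :=
  G.twinPathGraph v k₁ k₂ ⊔ edge (firstPath v k₁ k₂ (Fin.last k₁)) (secondPath v k₁ k₂ (Fin.last k₂))

/-- `G` is `(v, k₁, k₂)`-paradoxical: `κ(Ĝ(v, k₁, k₂)) > κ(G̃(v, k₁, k₂))`. -/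
def IsParadoxical {V : Type*} [Fintype V] (G : SimpleGraph V) (v : V) (k₁ k₂ : ℕ) : Prop :=
  ∃ a b : ℝ≥0, IsKemenyConstant (G.twinPathGraph v k₁ k₂).randomWalkMatrix a ∧
    IsKemenyConstant (G.closedTwinPathGraph v k₁ k₂).randomWalkMatrix b ∧ b > a

/-! ### The expression `Φ_G(v, k₁, k₂)` -/

open Matrix in
/-- `φ_G(v) = 𝐝ᵀ (2 𝐟ᵛ 𝟏ᵀ - F) 𝐝`, where `𝐟ᵛ` is the `v`-th column of `F`. -/
noncomputable def phi {V : Type*} [Fintype V] (G : SimpleGraph V) (v : V) : ℝ :=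
  G.degVec ⬝ᵥ (((2 : ℝ) • vecMulVec (fun i => G.twoForestMatrix i v) 1 - G.twoForestMatrix) *ᵥ
    G.degVec)

end SimpleGraph

noncomputable def phi₁ (k₁ k₂ : ℝ) : ℝ :=
  -(2 / 3) * (k₁ + k₂) * (k₁ + k₂ - 1) + 2 * k₁ * k₂

noncomputable def phi₂ (k₁ k₂ : ℝ) : ℝ :=
  -(k₁ + k₂) * (5 * (k₁ + k₂) ^ 2 - (k₁ + k₂) - 1) + 12 * k₁ * k₂ * (k₁ + k₂ + 1)

noncomputable def phi₃ (k₁ k₂ : ℝ) : ℝ :=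
  -(k₁ + k₂ + 1) * (k₁ + k₂) * (k₁ + k₂ - 1) ^ 2

/-- `Φ_G(v, k₁, k₂)`, with `k = k₁ + k₂ + 1`, `m = m_G` and `τ = τ_G`. -/
noncomputable def SimpleGraph.Phi {V : Type*} [Fintype V] (G : SimpleGraph V) (v : V)
    (k₁ k₂ : ℕ) : ℝ :=
  let k : ℝ := k₁ + k₂ + 1
  let m : ℝ := G.numEdges
  let τ : ℝ := G.numSpanningTrees
  k * G.phi v + 4 * m ^ 2 * τ * k * phi₁ k₁ k₂ + 2 * m * τ * k / 3 * phi₂ k₁ k₂ +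
    2 * τ * k / 3 * phi₃ k₁ k₂

/-! With edges read as unit resistors, Kemeny's constant of a connected graph is `∑ d_i d_j R_ij /
(2 ∑ d_i)`, where `R` is effective resistance (`IsResistanceKernel.isKemenyConstant`). All that is
used of `R` is its zero diagonal and the equation `L R = c 𝟏ᵀ - 2 I`. For `G` such a kernel is `F /
τ`, by deleting edges from spanning trees (`isResistanceKernel_twoForestMatrix`).

Both enlarged graphs glue `G` at `v` to a graph on `k` vertices: a path for `G̃`, a cycle for `Ĝ`.
Resistances add across the glued vertex, so the degree-weighted sum splits into a part from `G`, a
part from the path or cycle, and mixed terms involving only resistances to the glued vertex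
(`IsOneSum.sum_degVec_mul_degVec_mul`).

Resistances of paths and cycles are explicit, so both constants become closed formulas in the same
two data of `G`, namely `𝐝ᵀ F 𝐝` and `𝐝ᵀ 𝐟ᵛ`. `Phi_eq` then shows that `Φ` is a positive multiple of
their difference. -/

namespace SimpleGraph

open Classical in
/-- A kernel `R` with zero diagonal which, like the effective resistance, satisfies
`L R = c 𝟏ᵀ - 2 I` for the Laplacian `L` of `G` and some vector `c`. -/
def IsResistanceKernel {V : Type*} [Fintype V] (G : SimpleGraph V) (R : V → V → ℝ) : Prop :=
  (∀ i, R i i = 0) ∧ ∃ c : V → ℝ, ∀ i j,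
    ∑ x, (if G.Adj i x then R i j - R x j else 0) = c i - if i = j then 2 else 0

/-! ### Spanning trees, two-tree forests and the matrix `F` -/

section Forests

variable {V : Type*}

theorem reachable_of_reachable_sup_edge {F : SimpleGraph V} {u v a b : V}
    (h : (F ⊔ edge u v).Reachable a b) :
    F.Reachable a b ∨ (F.Reachable a u ∧ F.Reachable v b) ∨
      (F.Reachable a v ∧ F.Reachable u b) := by
  obtain ⟨p⟩ := h
  induction p with
  | nil => exact Or.inl .rfl
  | cons h p ih =>
    rw [sup_adj, edge_adj] at h
    rcases h with h | ⟨⟨rfl, rfl⟩ | ⟨rfl, rfl⟩, -⟩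
    · have h := h.reachable
      rcases ih with ih | ⟨ih, ih'⟩ | ⟨ih, ih'⟩
      · exact Or.inl (h.trans ih)
      · exact Or.inr (Or.inl ⟨h.trans ih, ih'⟩)
      · exact Or.inr (Or.inr ⟨h.trans ih, ih'⟩)
    · rcases ih with ih | ⟨ih, ih'⟩ | ⟨ih, ih'⟩
      · exact Or.inr (Or.inl ⟨.rfl, ih⟩)
      · exact Or.inr (Or.inl ⟨.rfl, ih'⟩)
      · exact Or.inl ih'
    · rcases ih with ih | ⟨ih, ih'⟩ | ⟨ih, ih'⟩
      · exact Or.inr (Or.inr ⟨.rfl, ih⟩)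
      · exact Or.inl ih'
      · exact Or.inr (Or.inr ⟨.rfl, ih'⟩)

theorem card_connectedComponent_eq_two_iff {F : SimpleGraph V} {i x : V}
    (h : ¬ F.Reachable i x) :
    Nat.card F.ConnectedComponent = 2 ↔ ∀ y, F.Reachable y i ∨ F.Reachable y x := by
  rw [Nat.card_eq_two_iff' (F.connectedComponentMk i)]
  constructor
  · rintro ⟨d, hd, hu⟩ y
    by_contra! hy
    have h1 := hu (F.connectedComponentMk y) (fun e => hy.1 (ConnectedComponent.exact e))
    have h2 := hu (F.connectedComponentMk x) (fun e => h (ConnectedComponent.exact e.symm))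
    exact hy.2 (ConnectedComponent.exact (h1.trans h2.symm))
  · intro H
    refine ⟨F.connectedComponentMk x, fun e => h (ConnectedComponent.exact e.symm), ?_⟩
    intro d
    induction d using ConnectedComponent.ind with
    | h y =>
      intro hy
      rcases H y with H | H
      · exact absurd (ConnectedComponent.sound H) hy
      · exact ConnectedComponent.sound H

theorem deleteEdges_sup_edge_of_adj {T : SimpleGraph V} {i x : V} (h : T.Adj i x) :
    T.deleteEdges {s(i, x)} ⊔ edge i x = T := by
  ext a b
  rw [sup_adj, deleteEdges_adj, adj_edge]
  by_cases hab : s(i, x) = s(a, b)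
  · have : T.Adj a b := by rwa [← mem_edgeSet, ← hab]
    simp [hab, this, this.ne]
  · simp [hab, Ne.symm hab]

theorem sup_edge_deleteEdges_of_not_adj {T : SimpleGraph V} {i x : V} (h : ¬ T.Adj i x) :
    (T ⊔ edge i x).deleteEdges {s(i, x)} = T := by
  ext a b
  rw [deleteEdges_adj, sup_adj, adj_edge]
  by_cases hab : s(i, x) = s(a, b)
  · have : ¬ T.Adj a b := by rwa [← mem_edgeSet, ← hab]
    simp [hab, this]
  · simp [hab, Ne.symm hab]

theorem IsTree.not_reachable_deleteEdges {T : SimpleGraph V} (hT : T.IsTree) {i x : V}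
    (h : T.Adj i x) : ¬ (T.deleteEdges {s(i, x)}).Reachable i x :=
  isBridge_iff.1 (isAcyclic_iff_forall_adj_isBridge.1 hT.isAcyclic h)

theorem IsTree.reachable_deleteEdges_or {T : SimpleGraph V} (hT : T.IsTree) {i x : V}
    (h : T.Adj i x) (y : V) :
    (T.deleteEdges {s(i, x)}).Reachable y i ∨ (T.deleteEdges {s(i, x)}).Reachable y x := by
  have := hT.connected.preconnected y i
  rw [← deleteEdges_sup_edge_of_adj h] at this
  rcases reachable_of_reachable_sup_edge this with h | h | h
  · exact Or.inl h
  · exact Or.inl h.1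
  · exact Or.inr h.1

/-- In a tree, exactly one neighbour of `i` is the first vertex on the way to `j ≠ i`. -/
theorem IsTree.existsUnique_adj_reachable {T : SimpleGraph V} (hT : T.IsTree) {i j : V}
    (hij : i ≠ j) : ∃! x, T.Adj i x ∧ (T.deleteEdges {s(i, x)}).Reachable x j := by
  obtain ⟨p, hp, hu⟩ := hT.existsUnique_path i j
  cases p with
  | nil => exact absurd rfl hij
  | @cons _ x _ h q =>
    rw [Walk.cons_isPath_iff] at hp
    refine ⟨x, ⟨h, reachable_deleteEdges_iff_exists_walk.2
      ⟨q, fun he => hp.2 (q.fst_mem_support_of_mem_edges he)⟩⟩, ?_⟩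
    rintro y ⟨hy, hr⟩
    classical
    -- A visit to `i` would join `y` to `i` without the edge `iy`, which is a bridge. So prepending
    -- `i` gives a path, and uniqueness of paths forces `y = x`.
    have hni : i ∉ ((hr.some.mapLe (deleteEdges_le _)).toPath : T.Walk y j).support := by
      intro hi
      have hi' := Walk.support_toPath_subset_support _ hi
      rw [Walk.support_mapLe_eq_support] at hi'
      exact hT.not_reachable_deleteEdges hy ⟨(hr.some.takeUntil i hi').reverse⟩
    have := hu (Walk.cons hy _) ((Walk.cons_isPath_iff _ _).2 ⟨Path.isPath _, hni⟩)
    simp only [Walk.cons.injEq] at this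
    exact this.1

/-- `T` is a spanning forest of `G` with exactly two trees. -/
def IsTwoForest (G T : SimpleGraph V) : Prop :=
  T ≤ G ∧ T.IsAcyclic ∧ Nat.card T.ConnectedComponent = 2

noncomputable instance fintypeOfFintype [Fintype V] : Fintype (SimpleGraph V) := Fintype.ofFinite _

theorem IsTwoForest.reachable_or {G T : SimpleGraph V} (h : G.IsTwoForest T) {i x : V}
    (hix : ¬ T.Reachable i x) (y : V) : T.Reachable y i ∨ T.Reachable y x :=
  (card_connectedComponent_eq_two_iff hix).1 h.2.2 y

variable [Fintype V]

open Classical in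
theorem ncard_eq_sum (P : SimpleGraph V → Prop) :
    (({T | P T} : Set (SimpleGraph V)).ncard : ℝ) = ∑ T, if P T then (1 : ℝ) else 0 := by
  rw [Finset.sum_boole, Set.ncard_eq_toFinset_card']
  congr 2
  ext; simp

open Classical in
theorem twoForestMatrix_apply (G : SimpleGraph V) (i j : V) :
    G.twoForestMatrix i j = ∑ T with G.IsTwoForest T, if T.Reachable i j then 0 else (1 : ℝ) := by
  rw [twoForestMatrix, ncard_eq_sum, Finset.sum_filter]
  refine Finset.sum_congr rfl fun T _ => ?_
  unfold IsTwoForest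
  split_ifs <;> tauto

-- Removing the edge `ix` from a spanning tree leaves two trees separating its ends; putting it back
-- reconnects them.
open Classical in
theorem sum_twoForest_eq_sum_tree (G : SimpleGraph V) {i x : V} (h : G.Adj i x)
    (φ : SimpleGraph V → ℝ) :
    ∑ T with G.IsTwoForest T ∧ ¬ T.Reachable i x, φ T =
      ∑ T with (T ≤ G ∧ T.IsTree) ∧ T.Adj i x, φ (T.deleteEdges {s(i, x)}) := by
  symm
  refine Finset.sum_bij' (fun T _ => T.deleteEdges {s(i, x)}) (fun T _ => T ⊔ edge i x)
    ?_ ?_ ?_ ?_ (fun _ _ => rfl)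
  · intro T hT
    simp only [Finset.mem_filter, Finset.mem_univ, true_and] at hT ⊢
    obtain ⟨⟨hle, hT⟩, hadj⟩ := hT
    have hn := hT.not_reachable_deleteEdges hadj
    exact ⟨⟨(deleteEdges_le _).trans hle, hT.isAcyclic.anti (deleteEdges_le _),
      (card_connectedComponent_eq_two_iff hn).2 (hT.reachable_deleteEdges_or hadj)⟩, hn⟩
  · intro T hT
    simp only [Finset.mem_filter, Finset.mem_univ, true_and] at hT ⊢
    have hn := hT.2
    have hadj : (T ⊔ edge i x).Adj i x := by simp [edge_adj, h.ne]
    refine ⟨⟨sup_le hT.1.1 ((edge_le_iff _).2 (Or.inr h)), ?_,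
      hT.1.2.1.sup_edge_of_not_reachable hn⟩, hadj⟩
    refine (connected_iff_exists_forall_reachable _).2 ⟨i, fun y => ?_⟩
    rcases hT.1.reachable_or hn y with hy | hy
    · exact (hy.mono le_sup_left).symm
    · exact hadj.reachable.trans (hy.mono le_sup_left).symm
  · intro T hT
    simp only [Finset.mem_filter, Finset.mem_univ, true_and] at hT
    exact deleteEdges_sup_edge_of_adj hT.2
  · intro T hT
    simp only [Finset.mem_filter, Finset.mem_univ, true_and] at hT
    exact sup_edge_deleteEdges_of_not_adj fun h => hT.2 h.reachable

-- Forests with `i` and `x` in one tree cancel. In any other, `j` lies with exactly one of them, and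
-- the forest counts `+1` if `j` is with `x`, `-1` if with `i`. The bijection with trees through
-- `ix` does the rest.
open Classical in
theorem twoForestMatrix_sub (G : SimpleGraph V) {i x : V} (h : G.Adj i x) (j : V) :
    G.twoForestMatrix i j - G.twoForestMatrix x j =
      ∑ T with (T ≤ G ∧ T.IsTree) ∧ T.Adj i x,
        ((if (T.deleteEdges {s(i, x)}).Reachable x j then 2 else 0) - 1 : ℝ) := by
  have key := sum_twoForest_eq_sum_tree G h fun T => ((if T.Reachable x j then 2 else 0) - 1 : ℝ)
  trans ∑ T with G.IsTwoForest T ∧ ¬ T.Reachable i x,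
    ((if T.Reachable x j then 2 else 0) - 1 : ℝ)
  swap
  · convert key
  rw [twoForestMatrix_apply, twoForestMatrix_apply, ← Finset.sum_sub_distrib, Finset.sum_filter,
    Finset.sum_filter]
  refine Finset.sum_congr rfl fun T _ => ?_
  by_cases hT : G.IsTwoForest T
  · by_cases hix : T.Reachable i x
    · have : T.Reachable i j ↔ T.Reachable x j := ⟨hix.symm.trans, hix.trans⟩
      simp [hix, this]
    · have h1 := hT.reachable_or hix j
      by_cases hij : T.Reachable i j
      · have : ¬ T.Reachable x j := fun h => hix (hij.trans h.symm)
        simp [hT, hix, hij, this]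
      · have : T.Reachable x j := h1.elim (fun h => absurd h.symm hij) (·.symm)
        simp [hT, hix, hij, this]; norm_num
  · simp [hT]

open Classical in
theorem IsTree.sum_adj_reachable {T : SimpleGraph V} (hT : T.IsTree) (i j : V) :
    ∑ x, (if T.Adj i x then if (T.deleteEdges {s(i, x)}).Reachable x j then (2 : ℝ) else 0 else 0)
      = if i = j then 0 else 2 := by
  split_ifs with hij
  · subst hij
    refine Finset.sum_eq_zero fun x _ => ?_
    split_ifs with h h'
    · exact absurd h'.symm (hT.not_reachable_deleteEdges h)
    · rfl
    · rfl
  · obtain ⟨x, ⟨hx, hx'⟩, hu⟩ := hT.existsUnique_adj_reachable hij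
    rw [Finset.sum_eq_single x, if_pos hx, if_pos hx']
    · intro y _ hy
      split_ifs with h h'
      · exact absurd (hu y ⟨h, h'⟩) hy
      · rfl
      · rfl
    · simp

theorem numSpanningTrees_pos {G : SimpleGraph V} (hG : G.Connected) :
    0 < G.numSpanningTrees := by
  obtain ⟨T, hle, hT⟩ := hG.exists_isTree_le
  exact (Set.ncard_pos (Set.toFinite _)).2 ⟨T, hle, hT⟩

theorem isResistanceKernel_twoForestMatrix {G : SimpleGraph V} (hG : G.Connected) :
    G.IsResistanceKernel fun i j => G.twoForestMatrix i j / G.numSpanningTrees := by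
  classical
  have hτ : (G.numSpanningTrees : ℝ) ≠ 0 := by exact_mod_cast (numSpanningTrees_pos hG).ne'
  -- The vector `c` is 2 minus the mean degree of `i` over all spanning trees: after exchanging
  -- sums, each tree `T` contributes `2 [i ≠ j] - deg_T i`.
  refine ⟨fun i => by simp [twoForestMatrix], fun i =>
    2 - (∑ T with T ≤ G ∧ T.IsTree, ∑ x, if T.Adj i x then (1 : ℝ) else 0) /
      G.numSpanningTrees, fun i j => ?_⟩
  have key : ∑ x, (if G.Adj i x then G.twoForestMatrix i j - G.twoForestMatrix x j else 0) =
      ∑ T with T ≤ G ∧ T.IsTree, ((if i = j then 0 else 2) -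
        ∑ x, if T.Adj i x then (1 : ℝ) else 0) := by
    calc _ = ∑ x, ∑ T with T ≤ G ∧ T.IsTree, (if T.Adj i x then
          ((if (T.deleteEdges {s(i, x)}).Reachable x j then 2 else 0) - 1 : ℝ) else 0) := by
          refine Finset.sum_congr rfl fun x _ => ?_
          split_ifs with h
          · rw [twoForestMatrix_sub G h, ← Finset.sum_filter, Finset.filter_filter]
          · refine (Finset.sum_eq_zero fun T hT => if_neg fun h' => h ?_).symm
            exact (Finset.mem_filter.1 hT).2.1 h'
      _ = _ := by
          rw [Finset.sum_comm]
          refine Finset.sum_congr rfl fun T hT => ?_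
          rw [← (Finset.mem_filter.1 hT).2.2.sum_adj_reachable i j, ← Finset.sum_sub_distrib]
          refine Finset.sum_congr rfl fun x _ => ?_
          split_ifs <;> simp
  have hτ' : (G.numSpanningTrees : ℝ) = ∑ T with T ≤ G ∧ T.IsTree, (1 : ℝ) := by
    rw [numSpanningTrees, ncard_eq_sum, Finset.sum_filter]
    congr! 2
  have : ∑ x, (if G.Adj i x then G.twoForestMatrix i j / G.numSpanningTrees -
      G.twoForestMatrix x j / G.numSpanningTrees else 0) =
      (∑ x, (if G.Adj i x then G.twoForestMatrix i j - G.twoForestMatrix x j else 0)) /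
        G.numSpanningTrees := by
    rw [Finset.sum_div]
    refine Finset.sum_congr rfl fun x _ => ?_
    split_ifs <;> ring
  rw [this, key, Finset.sum_sub_distrib, sub_div, ← mul_one (if i = j then (0 : ℝ) else 2)]
  rw [← Finset.mul_sum, ← hτ']
  field_simp
  split_ifs <;> ring

end Forests

end SimpleGraph

/-! ### Mean first passage times from first-step equations -/

section HittingTimes

variable {V : Type*} [Fintype V] {M : Matrix V V ℝ}

theorem tailProb_nonneg (hM : ∀ i x, 0 ≤ M i x) (j : V) (t : ℕ) (i : V) :
    0 ≤ tailProb M j t i := by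
  induction t generalizing i with
  | zero => simp [tailProb]
  | succ t ih =>
    rw [tailProb]
    exact Finset.sum_nonneg fun x _ => mul_nonneg (hM i x) (ih x)

open Classical in
theorem sum_range_succ_tailProb (j : V) (n : ℕ) (i : V) :
    ∑ t ∈ Finset.range (n + 1), tailProb M j t i =
      1 + ∑ x with x ≠ j, M i x * ∑ t ∈ Finset.range n, tailProb M j t x := by
  rw [Finset.sum_range_succ', add_comm]
  congr 1
  simp_rw [Finset.mul_sum]
  rw [Finset.sum_comm]
  rfl

variable {j : V} {h : V → ℝ}

open Classical in
theorem eq_one_add_sum_ne (hj : h j = 0) {i : V} (hi : h i = 1 + ∑ x, M i x * h x) :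
    h i = 1 + ∑ x with x ≠ j, M i x * h x := by
  rw [hi, Finset.sum_filter]
  congr 1
  refine Finset.sum_congr rfl fun x _ => ?_
  split_ifs with hx
  · rfl
  · rw [not_not.1 hx, hj, mul_zero]

/-- The left side is the mean of `T_j` truncated at `n`. It obeys the recursion that `h` solves, but
starts from 0, so it stays below `h`. -/
theorem sum_range_tailProb_le (hM : ∀ i x, 0 ≤ M i x) (hj : h j = 0) (hh : ∀ i, 0 ≤ h i)
    (hi : ∀ i, i ≠ j → h i = 1 + ∑ x, M i x * h x) (n : ℕ) (i : V) (hij : i ≠ j) :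
    ∑ t ∈ Finset.range n, tailProb M j t i ≤ h i := by
  classical
  induction n generalizing i with
  | zero => simpa using hh i
  | succ n ih =>
    rw [sum_range_succ_tailProb, eq_one_add_sum_ne hj (hi i hij)]
    gcongr with x hx
    · exact hM i x
    · exact ih x (by simpa using hx)

/-- Iterating the equation `n` times leaves a remainder weighted by the event `T_j > n`, on which
`h` is at most `C`. -/
theorem le_sum_range_tailProb_add (hM : ∀ i x, 0 ≤ M i x) (hj : h j = 0)
    (hi : ∀ i, i ≠ j → h i = 1 + ∑ x, M i x * h x) {C : ℝ} (hC : ∀ i, h i ≤ C) (n : ℕ) (i : V)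
    (hij : i ≠ j) :
    h i ≤ ∑ t ∈ Finset.range n, tailProb M j t i + C * tailProb M j n i := by
  classical
  induction n generalizing i with
  | zero => simpa [tailProb] using hC i
  | succ n ih =>
    rw [sum_range_succ_tailProb, eq_one_add_sum_ne hj (hi i hij), tailProb, Finset.mul_sum,
      add_assoc, ← Finset.sum_add_distrib]
    gcongr 1 + ?_
    refine Finset.sum_le_sum fun x hx => ?_
    have := mul_le_mul_of_nonneg_left (ih x (by simpa using hx)) (hM i x)
    linarith

/-- A nonnegative solution of the first-step equations gives the mean first passage times. -/
theorem meanFirstPassageTime_eq (hM : ∀ i x, 0 ≤ M i x) (hj : h j = 0) (hh : ∀ i, 0 ≤ h i)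
    (hi : ∀ i, i ≠ j → h i = 1 + ∑ x, M i x * h x) (i : V) (hij : i ≠ j) :
    meanFirstPassageTime M i j = ENNReal.ofReal (h i) := by
  have hnn := fun t => tailProb_nonneg hM j t i
  have hle := fun n => sum_range_tailProb_le hM hj hh hi n i hij
  have hsum : Summable fun t => tailProb M j t i := summable_of_sum_range_le hnn hle
  obtain ⟨C, hC⟩ : ∃ C, ∀ i, h i ≤ C :=
    ⟨∑ i, h i, fun i => Finset.single_le_sum (fun x _ => hh x) (Finset.mem_univ i)⟩
  -- The upper bound makes the tails summable, hence they tend to 0, and this kills the error term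
  -- of the lower bound.
  have heq : ∑' t, tailProb M j t i = h i := by
    refine le_antisymm (hsum.tsum_le_of_sum_range_le hle) ?_
    have hlim := hsum.hasSum.tendsto_sum_nat.add (hsum.tendsto_atTop_zero.const_mul C)
    rw [mul_zero, add_zero] at hlim
    exact ge_of_tendsto' hlim fun n => le_sum_range_tailProb_add hM hj hi hC n i hij
  rw [meanFirstPassageTime, ← heq, ENNReal.ofReal_tsum_of_nonneg hnn hsum]

end HittingTimes

/-! ### Stationary distribution and Kemeny's constant from resistances -/

namespace SimpleGraph

variable {V : Type*} [Fintype V] {G : SimpleGraph V}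

open Classical in
theorem degVec_eq_sum (G : SimpleGraph V) (i : V) :
    G.degVec i = ∑ x, if G.Adj i x then (1 : ℝ) else 0 := by
  rw [degVec, degree_eq_sum_if_adj]

theorem degVec_pos [Nontrivial V] (hG : G.Connected) (i : V) : 0 < G.degVec i := by
  classical
  rw [degVec]
  exact_mod_cast hG.preconnected.degree_pos_of_nontrivial i

theorem randomWalkMatrix_nonneg (G : SimpleGraph V) (i x : V) : 0 ≤ G.randomWalkMatrix i x := by
  unfold randomWalkMatrix degVec
  split_ifs <;> positivity

open Classical in
theorem degVec_mul_randomWalkMatrix (G : SimpleGraph V) (i x : V) :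
    G.degVec i * G.randomWalkMatrix i x = if G.Adj i x then 1 else 0 := by
  unfold randomWalkMatrix
  split_ifs with h
  · refine mul_one_div_cancel ?_
    rw [degVec, Nat.cast_ne_zero, ← pos_iff_ne_zero, degree_pos_iff_exists_adj]
    exact ⟨x, h⟩
  · simp

-- The Laplacian factors as the degree matrix times `I - P`; this turns Laplacian equations into
-- first-step equations.
open Classical in
theorem sum_adj_sub (G : SimpleGraph V) (f : V → ℝ) (i : V) :
    ∑ x, (if G.Adj i x then f i - f x else 0) =
      G.degVec i * (f i - ∑ x, G.randomWalkMatrix i x * f x) := by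
  rw [mul_sub, Finset.mul_sum, degVec_eq_sum, Finset.sum_mul, ← Finset.sum_sub_distrib]
  refine Finset.sum_congr rfl fun x _ => ?_
  rw [← mul_assoc, ← degVec_eq_sum, degVec_mul_randomWalkMatrix]
  split_ifs <;> simp

open Classical in
theorem eq_of_forall_sum_adj_sub_eq_zero (hG : G.Connected) {f : V → ℝ}
    (hf : ∀ i, ∑ x, (if G.Adj i x then f i - f x else 0) = 0) (i j : V) : f i = f j := by
  refine (G.lapMatrix_mulVec_eq_zero_iff_forall_reachable (x := f)).1 ?_ i j (hG.preconnected i j)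
  ext i
  rw [lapMatrix_mulVec_apply, Pi.zero_apply, ← hf i, neighborFinset_eq_filter, Finset.sum_filter,
    degree_eq_sum_if_adj, Finset.sum_mul, ← Finset.sum_sub_distrib]
  refine Finset.sum_congr rfl fun x _ => ?_
  split_ifs <;> simp

/-- By reversibility, stationarity of `w` says that `w / d` is harmonic. On a connected graph it is
then constant, and the total mass fixes the constant. -/
theorem isStationaryDistribution_iff [Nontrivial V] (hG : G.Connected) (w : V → ℝ) :
    IsStationaryDistribution G.randomWalkMatrix w ↔ w = fun i => G.degVec i / ∑ x, G.degVec x := by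
  classical
  have hd := degVec_pos hG
  have hD : 0 < ∑ x, G.degVec x := Finset.sum_pos (fun i _ => hd i) Finset.univ_nonempty
  have hP : ∀ i j, G.randomWalkMatrix i j = (if G.Adj j i then 1 else 0) / G.degVec i := by
    intro i j
    rw [G.adj_comm, ← degVec_mul_randomWalkMatrix, mul_div_cancel_left₀ _ (hd i).ne']
  constructor
  · intro hw
    obtain ⟨i₀⟩ := hG.nonempty
    have hc : ∀ i, w i / G.degVec i = w i₀ / G.degVec i₀ := fun i => by
      refine eq_of_forall_sum_adj_sub_eq_zero hG (f := fun i => w i / G.degVec i) (fun i => ?_) i i₀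
      have h1 : ∑ x, (if G.Adj i x then w x / G.degVec x else 0) = w i := by
        conv_rhs => rw [← hw.vecMul_eq]
        rw [Matrix.vecMul, dotProduct]
        refine Finset.sum_congr rfl fun x _ => ?_
        rw [hP]
        split_ifs <;> simp [div_eq_mul_inv]
      have h2 : ∑ x, (if G.Adj i x then w i / G.degVec i else 0) = w i := by
        rw [Finset.sum_congr rfl fun x _ => (mul_boole (G.Adj i x) (w i / G.degVec i)).symm,
          ← Finset.mul_sum, ← degVec_eq_sum, div_mul_cancel₀ _ (hd i).ne']
      calc _ = ∑ x, (if G.Adj i x then w i / G.degVec i else 0) -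
          ∑ x, (if G.Adj i x then w x / G.degVec x else 0) := by
            rw [← Finset.sum_sub_distrib]
            refine Finset.sum_congr rfl fun x _ => ?_
            split_ifs <;> simp
        _ = 0 := by rw [h1, h2, sub_self]
    have hw' : ∀ i, w i = w i₀ / G.degVec i₀ * G.degVec i := fun i => by
      rw [← hc i, div_mul_cancel₀ _ (hd i).ne']
    have h1 := hw.sum_eq_one
    rw [Finset.sum_congr rfl fun i _ => hw' i, ← Finset.mul_sum] at h1
    ext i
    rw [hw' i, eq_div_iff hD.ne', mul_right_comm, h1, one_mul]
  · rintro rfl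
    refine ⟨fun i => (div_pos (hd i) hD).le, ?_, ?_⟩
    · rw [← Finset.sum_div, div_self hD.ne']
    · ext i
      rw [Matrix.vecMul, dotProduct, G.degVec_eq_sum i, Finset.sum_div]
      refine Finset.sum_congr rfl fun x _ => ?_
      have := (hd x).ne'
      rw [hP]
      field_simp

/-- Kemeny's constant of a random walk in terms of effective resistances. -/
theorem IsResistanceKernel.isKemenyConstant [Nontrivial V] (hG : G.Connected) {R : V → V → ℝ}
    (hR : G.IsResistanceKernel R) :
    ∃ κ : ℝ≥0, IsKemenyConstant G.randomWalkMatrix κ ∧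
      (κ : ℝ) = (∑ i, ∑ j, G.degVec i * G.degVec j * R i j) / (2 * ∑ i, G.degVec i) := by
  classical
  obtain ⟨hR0, c, hc⟩ := hR
  have hd := degVec_pos hG
  set D := ∑ x, G.degVec x with hDdef
  have hD : 0 < D := Finset.sum_pos (fun i _ => hd i) Finset.univ_nonempty
  -- Candidate hitting times. For `i ≠ j` the Laplacian of `D R_ij / 2` is `D c_i / 2` and that of
  -- `∑ d_x R_ix / 2` is `D c_i / 2 - d_i`, so the difference is `d_i`. The term in `R j x` is
  -- constant in `i` and makes `h j j = 0`.
  let h : V → V → ℝ := fun i j => (D * R i j + ∑ x, G.degVec x * (R j x - R i x)) / 2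
  have hdiag : ∀ j, h j j = 0 := fun j => by simp [h, hR0]
  have hlap : ∀ i j, i ≠ j → ∑ x, (if G.Adj i x then h i j - h x j else 0) = G.degVec i := by
    intro i j hij
    have e1 : ∀ x, (if G.Adj i x then h i j - h x j else 0) =
        D / 2 * (if G.Adj i x then R i j - R x j else 0) -
          (∑ y, G.degVec y * (if G.Adj i x then R i y - R x y else 0)) / 2 := by
      intro x
      split_ifs
      · simp only [h, mul_sub, Finset.sum_sub_distrib]
        ring
      · simp
    rw [Finset.sum_congr rfl fun x _ => e1 x, Finset.sum_sub_distrib, ← Finset.mul_sum, hc,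
      if_neg hij, ← Finset.sum_div, Finset.sum_comm]
    simp_rw [← Finset.mul_sum, hc, mul_sub, Finset.sum_sub_distrib, ← Finset.sum_mul]
    simp only [mul_ite, mul_zero, Finset.sum_ite_eq, Finset.mem_univ, if_true]
    ring
  have hstep : ∀ j i, i ≠ j → h i j = 1 + ∑ x, G.randomWalkMatrix i x * h x j := by
    intro j i hij
    have := hlap i j hij
    rw [sum_adj_sub G (fun x => h x j) i] at this
    have h1 := mul_left_cancel₀ (hd i).ne' (this.trans (mul_one _).symm)
    linarith
  -- Minimum principle: at a minimiser other than `j` the Laplacian would be nonpositive, yet it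
  -- equals the degree. So the minimum is `h j j = 0`.
  have hnn : ∀ j i, 0 ≤ h i j := by
    intro j
    obtain ⟨i₀, -, hmin⟩ := Finset.exists_min_image Finset.univ (fun i => h i j)
      Finset.univ_nonempty
    suffices hi₀ : i₀ = j by
      intro i
      have := hmin i (Finset.mem_univ i)
      rwa [hi₀, hdiag] at this
    by_contra hij
    have h1 := hlap i₀ j hij
    have h2 : ∑ x, (if G.Adj i₀ x then h i₀ j - h x j else 0) ≤ 0 := by
      refine Finset.sum_nonpos fun x _ => ?_
      split_ifs
      · linarith [hmin x (Finset.mem_univ x)]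
      · rfl
    linarith [hd i₀]
  -- After averaging over `j`, the two terms depending on `i` cancel; this is why the constant does
  -- not depend on the starting vertex.
  have hval : ∀ i, ∑ j, h i j * (G.degVec j / D) =
      (∑ i, ∑ j, G.degVec i * G.degVec j * R i j) / (2 * D) := by
    intro i
    have e1 : ∀ j, h i j * (G.degVec j / D) = (D * (G.degVec j * R i j) +
        ∑ x, G.degVec j * G.degVec x * R j x - G.degVec j * ∑ x, G.degVec x * R i x) /
          (2 * D) := by
      intro j
      simp only [h, mul_sub, Finset.sum_sub_distrib, mul_assoc, ← Finset.mul_sum]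
      field_simp
      ring
    rw [Finset.sum_congr rfl fun j _ => e1 j, ← Finset.sum_div, Finset.sum_sub_distrib,
      Finset.sum_add_distrib, ← Finset.mul_sum, ← Finset.sum_mul, ← hDdef]
    congr 1
    ring
  have hκ : 0 ≤ (∑ i, ∑ j, G.degVec i * G.degVec j * R i j) / (2 * D) := by
    obtain ⟨i⟩ := hG.nonempty
    rw [← hval i]
    exact Finset.sum_nonneg fun j _ => mul_nonneg (hnn j i) (div_pos (hd j) hD).le
  refine ⟨⟨_, hκ⟩, ⟨?_, ?_⟩, rfl⟩
  · simp_rw [isStationaryDistribution_iff hG]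
    exact existsUnique_eq
  · intro w hw i
    rw [isStationaryDistribution_iff hG] at hw
    subst hw
    have e1 : ∑ j with j ≠ i, meanFirstPassageTime G.randomWalkMatrix i j *
        ENNReal.ofReal (G.degVec j / D) = ∑ j, ENNReal.ofReal (h i j * (G.degVec j / D)) := by
      rw [Finset.sum_filter]
      refine Finset.sum_congr rfl fun j _ => ?_
      split_ifs with hij
      · rw [meanFirstPassageTime_eq (h := fun i => h i j) (randomWalkMatrix_nonneg G) (hdiag j)
          (hnn j) (hstep j) i (Ne.symm hij), ENNReal.ofReal_mul (hnn j i)]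
      · rw [not_not.1 hij, hdiag]
        simp
    rw [e1, ← ENNReal.ofReal_sum_of_nonneg
      (fun j _ => mul_nonneg (hnn j i) (div_pos (hd j) hD).le), hval, ENNReal.ofReal]
    congr 1
    exact Real.toNNReal_of_nonneg hκ

end SimpleGraph

/-! ### Gluing two graphs at a vertex -/

namespace SimpleGraph

/-- `H` is obtained from `G` and `N` by identifying the vertex `v` of `G` with the vertex `o` of
`N`; the retractions of `H` onto `G` and `N` are `g` and `p`. -/
structure IsOneSum {V P W : Type*} (G : SimpleGraph V) (v : V) (N : SimpleGraph P) (o : P)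
    (H : SimpleGraph W) (i : V → W) (q : P → W) (g : W → V) (p : W → P) : Prop where
  g_i : ∀ x, g (i x) = x
  p_i : ∀ x, p (i x) = o
  g_q : ∀ t, g (q t) = v
  p_q : ∀ t, p (q t) = t
  i_g : ∀ y, p y = o → i (g y) = y
  q_p : ∀ y, g y = v → q (p y) = y
  cover : ∀ y, p y = o ∨ g y = v
  adj_iff : ∀ y z, H.Adj y z ↔ (p y = o ∧ p z = o ∧ G.Adj (g y) (g z)) ∨
    (g y = v ∧ g z = v ∧ N.Adj (p y) (p z))

namespace IsOneSum

variable {V P W : Type*} [Fintype W] {G : SimpleGraph V} {v : V}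
  {N : SimpleGraph P} {o : P} {H : SimpleGraph W} {i : V → W} {q : P → W} {g : W → V} {p : W → P}

open Classical in
theorem sum_p_eq [Fintype V] (h : IsOneSum G v N o H i q g p) (φ : W → ℝ) :
    ∑ y, (if p y = o then φ y else 0) = ∑ x, φ (i x) := by
  rw [← Finset.sum_filter]
  refine Finset.sum_bij' (fun y _ => g y) (fun x _ => i x) (by simp) (by simp [h.p_i]) ?_
    (by simp [h.g_i]) ?_
  · intro y hy
    exact h.i_g y (by simpa using hy)
  · intro y hy
    rw [h.i_g y (by simpa using hy)]

open Classical in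
theorem sum_g_eq [Fintype P] (h : IsOneSum G v N o H i q g p) (φ : W → ℝ) :
    ∑ y, (if g y = v then φ y else 0) = ∑ t, φ (q t) := by
  rw [← Finset.sum_filter]
  refine Finset.sum_bij' (fun y _ => p y) (fun x _ => q x) (by simp) (by simp [h.g_q]) ?_
    (by simp [h.p_q]) ?_
  · intro y hy
    exact h.q_p y (by simpa using hy)
  · intro y hy
    rw [h.q_p y (by simpa using hy)]

variable [Fintype V] [Fintype P]

-- The two copies share only the glued vertex, so each edge lies in exactly one of them.
open Classical in
theorem sum_adj (h : IsOneSum G v N o H i q g p) (y : W) (φ : W → ℝ) :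
    ∑ z, (if H.Adj y z then φ z else 0) =
      (if p y = o then ∑ x, (if G.Adj (g y) x then φ (i x) else 0) else 0) +
      (if g y = v then ∑ t, (if N.Adj (p y) t then φ (q t) else 0) else 0) := by
  have e1 : ∀ z, (if H.Adj y z then φ z else 0) =
      (if p y = o then (if p z = o then (if G.Adj (g y) (g z) then φ z else 0) else 0) else 0) +
      (if g y = v then (if g z = v then (if N.Adj (p y) (p z) then φ z else 0) else 0) else 0) := by
    intro z
    have hz := h.adj_iff y z
    have hv : ¬ G.Adj v v := G.irrefl
    by_cases h1 : p y = o <;> by_cases h2 : p z = o <;> by_cases h3 : g y = v <;>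
      by_cases h4 : g z = v <;> simp [h1, h2, h3, h4, hz]
  rw [Finset.sum_congr rfl fun z _ => e1 z, Finset.sum_add_distrib]
  congr 1
  · split_ifs
    · rw [h.sum_p_eq]
      simp_rw [h.g_i]
    · simp
  · split_ifs
    · rw [h.sum_g_eq]
      simp_rw [h.p_q]
    · simp

open Classical in
theorem degVec_eq (h : IsOneSum G v N o H i q g p) (y : W) :
    H.degVec y = (if p y = o then G.degVec (g y) else 0) + if g y = v then N.degVec (p y) else 0 := by
  rw [degVec_eq_sum, h.sum_adj, degVec_eq_sum, degVec_eq_sum]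

/-- The degree of the glued vertex is the sum of its degrees in both parts, so degree-weighted sums
split with no correction term. -/
theorem sum_degVec_mul (h : IsOneSum G v N o H i q g p) (φ : W → ℝ) :
    ∑ y, H.degVec y * φ y = ∑ x, G.degVec x * φ (i x) + ∑ t, N.degVec t * φ (q t) := by
  classical
  simp_rw [h.degVec_eq, add_mul, ite_mul, zero_mul, Finset.sum_add_distrib]
  rw [h.sum_p_eq, h.sum_g_eq]
  simp_rw [h.g_i, h.p_q]

/-- The effective resistances of a one-sum. -/
theorem isResistanceKernel (h : IsOneSum G v N o H i q g p) {R : V → V → ℝ} {S : P → P → ℝ}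
    (hR : G.IsResistanceKernel R) (hS : N.IsResistanceKernel S) :
    H.IsResistanceKernel fun y z => R (g y) (g z) + S (p y) (p z) := by
  classical
  obtain ⟨hR0, c, hc⟩ := hR
  obtain ⟨hS0, d, hd⟩ := hS
  -- At the glued vertex both Laplacians contribute. Any other `z` agrees with it under exactly one
  -- retraction, giving `-2`, while the glued vertex itself gives `-4`; hence the constant `-2`
  -- here.
  refine ⟨fun y => by simp [hR0, hS0], fun y => (if p y = o then c (g y) else 0) +
    (if g y = v then d (p y) else 0) - if p y = o ∧ g y = v then 2 else 0, fun y z => ?_⟩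
  rw [h.sum_adj]
  simp_rw [h.g_i, h.p_i, h.g_q, h.p_q]
  have e1 : p y = o → ∑ x, (if G.Adj (g y) x then R (g y) (g z) + S (p y) (p z) -
      (R x (g z) + S o (p z)) else 0) = c (g y) - if g y = g z then 2 else 0 := by
    intro hy
    rw [← hc]
    refine Finset.sum_congr rfl fun x _ => ?_
    rw [hy]
    congr 1
    ring
  have e2 : g y = v → ∑ t, (if N.Adj (p y) t then R (g y) (g z) + S (p y) (p z) -
      (R v (g z) + S t (p z)) else 0) = d (p y) - if p y = p z then 2 else 0 := by
    intro hy
    rw [← hd]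
    refine Finset.sum_congr rfl fun x _ => ?_
    rw [hy]
    congr 1
    ring
  have hyz : y = z ↔ g y = g z ∧ p y = p z := by
    refine ⟨by rintro rfl; simp, fun ⟨h1, h2⟩ => ?_⟩
    rcases h.cover y with hy | hy
    · rw [← h.i_g y hy, h1, h.i_g z (h2 ▸ hy)]
    · rw [← h.q_p y hy, h2, h.q_p z (h1 ▸ hy)]
  have e3 := h.cover y
  have e4 := h.cover z
  by_cases h1 : p y = o <;> by_cases h2 : g y = v
  · rw [if_pos h1, if_pos h2, e1 h1, e2 h2, if_pos h1, if_pos h2, if_pos (And.intro h1 h2)]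
    rw [hyz, h1, h2]
    by_cases h3 : v = g z <;> by_cases h4 : o = p z <;> simp [h3, h4] <;> grind
  · rw [if_pos h1, if_neg h2, e1 h1, if_pos h1, if_neg h2, if_neg fun h : _ ∧ _ => h2 h.2]
    have : y = z ↔ g y = g z := by rw [hyz]; grind
    simp [this]
  · rw [if_neg h1, if_pos h2, e2 h2, if_neg h1, if_pos h2, if_neg fun h : _ ∧ _ => h1 h.1]
    have : y = z ↔ p y = p z := by rw [hyz]; grind
    simp [this]
  · tauto

theorem sum_degVec (h : IsOneSum G v N o H i q g p) :
    ∑ y, H.degVec y = ∑ x, G.degVec x + ∑ t, N.degVec t := by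
  simpa using h.sum_degVec_mul fun _ => 1

/-- A mixed pair `x`, `t` has resistance `R x v + S o t`. Each such pair occurs in both orders,
whence the factor 2. -/
theorem sum_degVec_mul_degVec_mul (h : IsOneSum G v N o H i q g p) {R : V → V → ℝ}
    {S : P → P → ℝ} (hR : ∀ x y, R x y = R y x) (hR0 : R v v = 0) (hS : ∀ x y, S x y = S y x)
    (hS0 : S o o = 0) :
    ∑ y, ∑ z, H.degVec y * H.degVec z * (R (g y) (g z) + S (p y) (p z)) =
      ∑ x, ∑ y, G.degVec x * G.degVec y * R x y + ∑ s, ∑ t, N.degVec s * N.degVec t * S s t +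
      2 * ((∑ t, N.degVec t) * ∑ x, G.degVec x * R x v +
        (∑ x, G.degVec x) * ∑ t, N.degVec t * S t o) := by
  simp_rw [mul_assoc, ← Finset.mul_sum]
  simp_rw [h.sum_degVec_mul, h.g_i, h.p_i, h.g_q, h.p_q, hR0, hS0, zero_add, add_zero]
  simp_rw [hR v, hS o, mul_add, Finset.sum_add_distrib, mul_add, Finset.sum_add_distrib]
  have e1 : ∑ x, G.degVec x * ∑ t, N.degVec t * R x v =
      (∑ t, N.degVec t) * ∑ x, G.degVec x * R x v := by
    rw [Finset.mul_sum]
    refine Finset.sum_congr rfl fun x _ => ?_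
    rw [← Finset.sum_mul]
    ring
  have e2 : ∑ t, N.degVec t * ∑ x, G.degVec x * S t o =
      (∑ x, G.degVec x) * ∑ t, N.degVec t * S t o := by
    rw [Finset.mul_sum]
    refine Finset.sum_congr rfl fun x _ => ?_
    rw [← Finset.sum_mul]
    ring
  rw [e1, e2, ← Finset.sum_mul, ← Finset.sum_mul]
  ring

omit [Fintype W] [Fintype V] [Fintype P] in
theorem connected (h : IsOneSum G v N o H i q g p) (hG : G.Connected) (hN : N.Connected) :
    H.Connected := by
  have hi : ∀ x y, H.Reachable (i x) (i y) := fun x y => (hG.preconnected x y).map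
    ⟨i, fun {a b} hab => (h.adj_iff _ _).2 (Or.inl ⟨h.p_i a, h.p_i b, by rwa [h.g_i, h.g_i]⟩)⟩
  have hq : ∀ s t, H.Reachable (q s) (q t) := fun s t => (hN.preconnected s t).map
    ⟨q, fun {a b} hab => (h.adj_iff _ _).2 (Or.inr ⟨h.g_q a, h.g_q b, by rwa [h.p_q, h.p_q]⟩)⟩
  have hiq : i v = q o := by
    rw [← h.q_p (i v) (h.g_i v), h.p_i]
  refine (connected_iff_exists_forall_reachable _).2 ⟨i v, fun y => ?_⟩
  rcases h.cover y with hy | hy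
  · rw [← h.i_g y hy]
    exact hi _ _
  · rw [← h.q_p y hy, hiq]
    exact hq _ _

end IsOneSum

end SimpleGraph

/-! ### Resistance sums for paths and cycles -/

namespace SimpleGraph

open Classical in
theorem sum_pathGraph_adj (n : ℕ) (s : Fin (n + 1)) (f : ℕ → ℝ) :
    ∑ t : Fin (n + 1), (if (pathGraph (n + 1)).Adj s t then f t else 0) =
      (if (s : ℕ) < n then f (s + 1) else 0) + if 0 < (s : ℕ) then f (s - 1) else 0 := by
  have hs := s.isLt
  have e : ∀ t : Fin (n + 1), (if (pathGraph (n + 1)).Adj s t then f t else 0) =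
      (if (s : ℕ) + 1 = t then f t else 0) +
        if 0 < (s : ℕ) then (if (s : ℕ) - 1 = t then f t else 0) else 0 := by
    intro t
    simp only [pathGraph_adj]
    by_cases h1 : (s : ℕ) + 1 = t
    · rw [if_pos (Or.inl h1), if_pos h1, if_neg (by omega : ¬ (s : ℕ) - 1 = t)]
      simp
    · by_cases h2 : (t : ℕ) + 1 = s
      · rw [if_pos (Or.inr h2), if_neg h1, if_pos (by omega), if_pos (by omega), zero_add]
      · rw [if_neg (by omega), if_neg h1, zero_add]
        split_ifs
        · omega
        · rfl
        · rfl
  rw [Finset.sum_congr rfl fun t _ => e t, Finset.sum_add_distrib,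
    Fin.sum_univ_eq_sum_range (fun t => if (s : ℕ) + 1 = t then f t else 0),
    Fin.sum_univ_eq_sum_range
      (fun t => if 0 < (s : ℕ) then (if (s : ℕ) - 1 = t then f t else 0) else 0)]
  congr 1
  · simp
  · split_ifs
    · rw [Finset.sum_ite_eq, if_pos (Finset.mem_range.2 (by omega))]
    · simp

/-- The cycle on the vertices `0, …, n`. -/
def closedPathGraph (n : ℕ) : SimpleGraph (Fin (n + 1)) :=
  pathGraph (n + 1) ⊔ edge 0 (Fin.last n)

-- With `2 ≤ n` the closing edge is not already an edge of the path, so nothing is counted twice.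
open Classical in
theorem sum_closedPathGraph_adj {n : ℕ} (hn : 2 ≤ n) (s : Fin (n + 1)) (f : ℕ → ℝ) :
    ∑ t : Fin (n + 1), (if (closedPathGraph n).Adj s t then f t else 0) =
      (if (s : ℕ) < n then f (s + 1) else f 0) + if 0 < (s : ℕ) then f (s - 1) else f n := by
  have e : ∀ t : Fin (n + 1), (if (closedPathGraph n).Adj s t then f t else 0) =
      (if (pathGraph (n + 1)).Adj s t then f t else 0) +
        ((if s = 0 then (if t = Fin.last n then f t else 0) else 0) +
          if s = Fin.last n then (if t = 0 then f t else 0) else 0) := by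
    intro t
    have h : (closedPathGraph n).Adj s t ↔ (pathGraph (n + 1)).Adj s t ∨
        (s = 0 ∧ t = Fin.last n) ∨ (s = Fin.last n ∧ t = 0) := by
      rw [closedPathGraph, sup_adj, edge_adj]
      simp only [pathGraph_adj, Fin.ext_iff, Fin.val_zero, Fin.val_last, ne_eq]
      omega
    simp only [h, pathGraph_adj, Fin.ext_iff, Fin.val_zero, Fin.val_last]
    split_ifs <;> first | omega | simp
  have hs := s.isLt
  rw [Finset.sum_congr rfl fun t _ => e t, Finset.sum_add_distrib, sum_pathGraph_adj,
    Finset.sum_add_distrib]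
  have h1 : s = 0 ↔ ¬ 0 < (s : ℕ) := by rw [Fin.ext_iff, Fin.val_zero]; omega
  have h2 : s = Fin.last n ↔ ¬ (s : ℕ) < n := by rw [Fin.ext_iff, Fin.val_last]; omega
  simp only [h1, h2]
  split_ifs <;> simp [add_comm]

theorem degVec_pathGraph (n : ℕ) (s : Fin (n + 1)) : (pathGraph (n + 1)).degVec s =
    (if (s : ℕ) < n then 1 else 0) + if 0 < (s : ℕ) then 1 else 0 := by
  rw [degVec_eq_sum, sum_pathGraph_adj n s fun _ => 1]

theorem degVec_closedPathGraph {n : ℕ} (hn : 2 ≤ n) (s : Fin (n + 1)) :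
    (closedPathGraph n).degVec s = 2 := by
  rw [degVec_eq_sum, sum_closedPathGraph_adj hn s fun _ => 1]
  split_ifs <;> norm_num

/-- A degree-weighted sum is a sum over edges of the values at both ends. -/
theorem sum_degVec_pathGraph_mul (n : ℕ) (f : ℕ → ℝ) :
    ∑ s : Fin (n + 1), (pathGraph (n + 1)).degVec s * f s =
      ∑ s ∈ Finset.range n, (f s + f (s + 1)) := by
  simp_rw [degVec_pathGraph, add_mul, ite_mul, one_mul, zero_mul, Finset.sum_add_distrib]
  rw [Fin.sum_univ_eq_sum_range (fun s => if s < n then f s else 0),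
    Fin.sum_univ_eq_sum_range (fun s => if 0 < s then f s else 0), Finset.sum_range_succ,
    Finset.sum_range_succ']
  simp only [lt_irrefl, if_false, add_zero, Nat.succ_pos, if_true]
  congr 1
  refine Finset.sum_congr rfl fun s hs => if_pos (Finset.mem_range.1 hs)

/-- Effective resistances of the path are distances. -/
theorem isResistanceKernel_pathGraph (n : ℕ) :
    (pathGraph (n + 1)).IsResistanceKernel fun s t => |((s : ℕ) : ℝ) - (t : ℕ)| := by
  classical
  -- This is 2 minus the degree of `s`, as the path is its own only spanning tree.
  refine ⟨by simp, fun s => (if (s : ℕ) < n then 0 else 1) + if 0 < (s : ℕ) then 0 else 1,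
    fun s t => ?_⟩
  rw [sum_pathGraph_adj n s fun x => |((s : ℕ) : ℝ) - (t : ℕ)| - |(x : ℝ) - (t : ℕ)|]
  have hs := s.isLt
  have ht := t.isLt
  simp only [Fin.ext_iff]
  generalize (s : ℕ) = s at *
  generalize (t : ℕ) = t at *
  rcases lt_trichotomy s t with h | rfl | h
  · have h' : (s : ℝ) + 1 ≤ t := by exact_mod_cast h
    have hsn : s < n := by omega
    rw [if_pos hsn, if_pos hsn, if_neg h.ne]
    split_ifs with h0
    · rw [Nat.cast_sub (by omega), abs_of_nonpos (by linarith), Nat.cast_add,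
        abs_of_nonpos (by push_cast; linarith), abs_of_nonpos (by push_cast; linarith)]
      push_cast; ring
    · rw [abs_of_nonpos (by linarith), Nat.cast_add, abs_of_nonpos (by push_cast; linarith)]
      push_cast; ring
  · rw [if_pos rfl, sub_self, abs_zero]
    split_ifs with h1 h2 h2
    · rw [Nat.cast_sub (by omega)]; norm_num
    · norm_num
    · rw [Nat.cast_sub (by omega)]; norm_num
    · norm_num
  · have h' : (t : ℝ) + 1 ≤ s := by exact_mod_cast h
    have h0 : 0 < s := by omega
    rw [if_pos h0, if_pos h0, if_neg h.ne', Nat.cast_sub (by omega),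
      abs_of_nonneg (by linarith : (0 : ℝ) ≤ s - t),
      abs_of_nonneg (by push_cast; linarith : (0 : ℝ) ≤ (s - (1 : ℕ) : ℝ) - t)]
    split_ifs with h1
    · rw [Nat.cast_add, abs_of_nonneg (by push_cast; linarith)]
      push_cast; ring
    · push_cast; ring

/-- Effective resistances of the cycle. -/
theorem isResistanceKernel_closedPathGraph {n : ℕ} (hn : 2 ≤ n) :
    (closedPathGraph n).IsResistanceKernel fun s t =>
      |((s : ℕ) : ℝ) - (t : ℕ)| * (n + 1 - |((s : ℕ) : ℝ) - (t : ℕ)|) / (n + 1) := by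
  classical
  -- The kernel is two arcs of lengths `x` and `n + 1 - x` in parallel. The second difference of `x
  -- (n + 1 - x) / (n + 1)` is `-2 / (n + 1)`, and the symmetry `x ↦ n + 1 - x` handles the
  -- wrap-around.
  refine ⟨by simp, fun s => 2 / (n + 1), fun s t => ?_⟩
  rw [sum_closedPathGraph_adj hn s fun x =>
    |((s : ℕ) : ℝ) - (t : ℕ)| * (n + 1 - |((s : ℕ) : ℝ) - (t : ℕ)|) / (n + 1) -
      |(x : ℝ) - (t : ℕ)| * (n + 1 - |(x : ℝ) - (t : ℕ)|) / (n + 1)]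
  have hs := s.isLt
  have ht := t.isLt
  simp only [Fin.ext_iff]
  generalize (s : ℕ) = s at *
  generalize (t : ℕ) = t at *
  have hn1 : (n : ℝ) + 1 ≠ 0 := by positivity
  have ht0 : (0 : ℝ) ≤ t := by positivity
  have htn : (t : ℝ) ≤ n := by exact_mod_cast Nat.lt_succ_iff.1 ht
  rcases lt_trichotomy s t with h | rfl | h
  · have h' : (s : ℝ) + 1 ≤ t := by exact_mod_cast h
    have hsn : s < n := by omega
    rw [if_pos hsn, if_neg h.ne, abs_of_nonpos (by linarith : (s : ℝ) - t ≤ 0),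
      Nat.cast_add, abs_of_nonpos (by push_cast; linarith : (s : ℝ) + (1 : ℕ) - t ≤ 0)]
    split_ifs with h0
    · rw [Nat.cast_sub (by omega), abs_of_nonpos (by push_cast; linarith)]
      push_cast; field_simp; ring
    · obtain rfl : s = 0 := by omega
      rw [abs_of_nonneg (by linarith)]
      push_cast; field_simp; ring
  · rw [if_pos rfl, sub_self, abs_zero]
    split_ifs with h1 h2 h2
    · rw [Nat.cast_sub (by omega)]
      norm_num; field_simp; ring
    · obtain rfl : s = 0 := by omega
      norm_num; field_simp; ring
    · obtain rfl : s = n := by omega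
      rw [Nat.cast_sub (by omega)]
      norm_num; field_simp; ring
    · omega
  · have h' : (t : ℝ) + 1 ≤ s := by exact_mod_cast h
    have h0 : 0 < s := by omega
    rw [if_pos h0, if_neg h.ne', Nat.cast_sub (by omega),
      abs_of_nonneg (by linarith : (0 : ℝ) ≤ s - t),
      abs_of_nonneg (by push_cast; linarith : (0 : ℝ) ≤ (s - (1 : ℕ) : ℝ) - t)]
    split_ifs with h1
    · rw [Nat.cast_add, abs_of_nonneg (by push_cast; linarith)]
      push_cast; field_simp; ring
    · obtain rfl : s = n := by omega
      rw [Nat.cast_zero, abs_of_nonpos (by linarith)]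
      push_cast; field_simp; ring

theorem sum_degVec_pathGraph (n : ℕ) : ∑ s, (pathGraph (n + 1)).degVec s = 2 * n := by
  have := sum_degVec_pathGraph_mul n fun _ => 1
  simp only [mul_one, Finset.sum_const, Finset.card_range, nsmul_eq_mul] at this
  rw [this]
  ring

/-- An edge whose ends are at distances `e` and `e + 1` from `a` contributes `2 e + 1`; the odd
numbers on each side of `a` add up to a square. -/
theorem sum_degVec_pathGraph_mul_abs {n a : ℕ} (ha : a ≤ n) :
    ∑ s : Fin (n + 1), (pathGraph (n + 1)).degVec s * |((s : ℕ) : ℝ) - a| =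
      (a : ℝ) ^ 2 + ((n : ℝ) - a) ^ 2 := by
  obtain ⟨b, rfl⟩ := Nat.exists_eq_add_of_le ha
  rw [sum_degVec_pathGraph_mul (a + b) fun s => |(s : ℝ) - a|, Finset.sum_range_add]
  have h1 : ∀ m ≤ a, ∑ s ∈ Finset.range m, (|(s : ℝ) - a| + |((s + 1 : ℕ) : ℝ) - a|) =
      2 * m * a - m ^ 2 := by
    intro m hm
    induction m with
    | zero => simp
    | succ m ih =>
      have : (m : ℝ) + 1 ≤ a := by exact_mod_cast hm
      rw [Finset.sum_range_succ, ih (by omega), abs_of_nonpos (by linarith),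
        abs_of_nonpos (by push_cast; linarith)]
      push_cast; ring
  have h2 : ∑ s ∈ Finset.range b, (|((a + s : ℕ) : ℝ) - a| + |((a + s + 1 : ℕ) : ℝ) - a|) =
      b ^ 2 := by
    induction b with
    | zero => simp
    | succ b ih =>
      rw [Finset.sum_range_succ, ih (by omega), abs_of_nonneg (by push_cast; linarith),
        abs_of_nonneg (by push_cast; linarith)]
      push_cast; ring
  rw [h1 a le_rfl, h2]
  push_cast; ring

theorem sum_degVec_pathGraph_mul_degVec_mul_abs (n : ℕ) :
    ∑ s : Fin (n + 1), ∑ t : Fin (n + 1), (pathGraph (n + 1)).degVec s *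
      (pathGraph (n + 1)).degVec t * |((s : ℕ) : ℝ) - (t : ℕ)| = 2 * n * (2 * n ^ 2 + 1) / 3 := by
  -- The `n` inside the summand is freed to `N`, so that induction on the number of terms leaves the
  -- summand fixed.
  have h : ∀ N : ℝ, ∑ s ∈ Finset.range n, ((s : ℝ) ^ 2 + (N - s) ^ 2 +
      (((s + 1 : ℕ) : ℝ) ^ 2 + (N - (s + 1 : ℕ)) ^ 2)) =
        (n * (2 * n ^ 2 + 1) + N * (2 * N ^ 2 + 1) - (N - n) * (2 * (N - n) ^ 2 + 1)) / 3 := by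
    intro N
    induction n with
    | zero => simp
    | succ n ih =>
      rw [Finset.sum_range_succ, ih]
      push_cast; ring
  rw [Finset.sum_comm]
  have e0 : ∀ t : Fin (n + 1), ∑ s : Fin (n + 1), (pathGraph (n + 1)).degVec s * (pathGraph (n + 1)).degVec t *
      |((s : ℕ) : ℝ) - (t : ℕ)| = (pathGraph (n + 1)).degVec t * ∑ s : Fin (n + 1), (pathGraph (n + 1)).degVec s *
        |((s : ℕ) : ℝ) - (t : ℕ)| := fun t => by
    rw [Finset.mul_sum]
    exact Finset.sum_congr rfl fun s _ => by ring
  have e : ∀ t : Fin (n + 1), ∑ s : Fin (n + 1), (pathGraph (n + 1)).degVec s *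
      |((s : ℕ) : ℝ) - (t : ℕ)| = ((t : ℕ) : ℝ) ^ 2 + ((n : ℝ) - (t : ℕ)) ^ 2 :=
    fun t => sum_degVec_pathGraph_mul_abs (Nat.lt_succ_iff.1 t.isLt)
  simp_rw [e0, e]
  rw [sum_degVec_pathGraph_mul n fun t => (t : ℝ) ^ 2 + ((n : ℝ) - t) ^ 2, h n]
  ring

theorem sum_degVec_closedPathGraph {n : ℕ} (hn : 2 ≤ n) :
    ∑ s, (closedPathGraph n).degVec s = 2 * (n + 1) := by
  simp_rw [degVec_closedPathGraph hn]
  simp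
  ring

/-- By rotational symmetry the value cannot depend on `a`. The computation splits the sum at `a`,
where the absolute value changes sign. -/
theorem sum_degVec_closedPathGraph_mul {n : ℕ} (hn : 2 ≤ n) {a : ℕ} (ha : a ≤ n) :
    ∑ s : Fin (n + 1), (closedPathGraph n).degVec s *
      (|((s : ℕ) : ℝ) - a| * (n + 1 - |((s : ℕ) : ℝ) - a|) / (n + 1)) = (n * (n + 2) : ℝ) / 3 := by
  simp_rw [degVec_closedPathGraph hn]
  obtain ⟨b, rfl⟩ := Nat.exists_eq_add_of_le ha
  rw [← Finset.mul_sum, ← Finset.sum_div]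
  generalize hK : (((a + b : ℕ) : ℝ) + 1) = K
  rw [Fin.sum_univ_eq_sum_range (fun s => |(s : ℝ) - a| * (K - |(s : ℝ) - a|)), add_assoc,
    Finset.sum_range_add]
  have h1 : ∀ m ≤ a, ∑ s ∈ Finset.range m, |(s : ℝ) - a| * (K - |(s : ℝ) - a|) =
      a * (K - a) * m + (2 * a - K) * (m * (m - 1)) / 2 - m * (m - 1) * (2 * m - 1) / 6 := by
    intro m hm
    induction m with
    | zero => simp
    | succ m ih =>
      have : (m : ℝ) + 1 ≤ a := by exact_mod_cast hm
      rw [Finset.sum_range_succ, ih (by omega), abs_of_nonpos (by linarith)]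
      push_cast; ring
  have h2 : ∀ m : ℕ, ∑ s ∈ Finset.range m,
      |((a + s : ℕ) : ℝ) - a| * (K - |((a + s : ℕ) : ℝ) - a|) =
      K * (m * (m - 1)) / 2 - m * (m - 1) * (2 * m - 1) / 6 := by
    intro m
    induction m with
    | zero => simp
    | succ b ih =>
      rw [Finset.sum_range_succ, ih, abs_of_nonneg (by push_cast; linarith)]
      push_cast; ring
  rw [h1 a le_rfl, h2]
  have hK0 : K ≠ 0 := by rw [← hK]; positivity
  field_simp
  rw [← hK]
  push_cast; ring

theorem sum_degVec_closedPathGraph_mul_degVec_mul {n : ℕ} (hn : 2 ≤ n) :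
    ∑ s : Fin (n + 1), ∑ t : Fin (n + 1), (closedPathGraph n).degVec s *
      (closedPathGraph n).degVec t *
        (|((s : ℕ) : ℝ) - (t : ℕ)| * (n + 1 - |((s : ℕ) : ℝ) - (t : ℕ)|) / (n + 1)) =
      2 * (n + 1) * (n * (n + 2)) / 3 := by
  rw [Finset.sum_comm]
  have e0 : ∀ t : Fin (n + 1), ∑ s : Fin (n + 1), (closedPathGraph n).degVec s * (closedPathGraph n).degVec t *
      (|((s : ℕ) : ℝ) - (t : ℕ)| * (n + 1 - |((s : ℕ) : ℝ) - (t : ℕ)|) / (n + 1)) = (closedPathGraph n).degVec t * ∑ s : Fin (n + 1), (closedPathGraph n).degVec s *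
        (|((s : ℕ) : ℝ) - (t : ℕ)| * (n + 1 - |((s : ℕ) : ℝ) - (t : ℕ)|) / (n + 1)) := fun t => by
    rw [Finset.mul_sum]
    exact Finset.sum_congr rfl fun s _ => by ring
  have e : ∀ t : Fin (n + 1), ∑ s : Fin (n + 1), (closedPathGraph n).degVec s *
      (|((s : ℕ) : ℝ) - (t : ℕ)| * (n + 1 - |((s : ℕ) : ℝ) - (t : ℕ)|) / (n + 1)) =
        (n * (n + 2) : ℝ) / 3 :=
    fun t => sum_degVec_closedPathGraph_mul hn (Nat.lt_succ_iff.1 t.isLt)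
  simp_rw [e0, e]
  rw [← Finset.sum_mul, sum_degVec_closedPathGraph hn]
  ring

end SimpleGraph

/-! ### The twin path graphs as one-sums -/

namespace SimpleGraph

section TwinPaths

variable {V : Type*} (v : V) (k₁ k₂ : ℕ)

/-- The retraction of the twin path graphs onto `G`. -/
def twinBase : V ⊕ (Fin k₁ ⊕ Fin k₂) → V := Sum.elim id fun _ => v

/-- The retraction of the twin path graphs onto the path formed by the two paths. -/
def twinPos : V ⊕ (Fin k₁ ⊕ Fin k₂) → Fin (k₁ + k₂ + 1) :=
  Sum.elim (fun _ => ⟨k₁, by omega⟩)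
    (Sum.elim (fun i => ⟨k₁ - 1 - i, by omega⟩) fun i => ⟨k₁ + 1 + i, by omega⟩)

/-- The vertices, in order, of the path formed by the two paths. -/
def twinVertex (t : Fin (k₁ + k₂ + 1)) : V ⊕ (Fin k₁ ⊕ Fin k₂) :=
  if h : (t : ℕ) < k₁ then Sum.inr (Sum.inl ⟨k₁ - 1 - t, by omega⟩)
  else if h' : (t : ℕ) = k₁ then Sum.inl v
  else Sum.inr (Sum.inr ⟨t - k₁ - 1, by omega⟩)

theorem twinBase_twinVertex (t : Fin (k₁ + k₂ + 1)) :
    twinBase v k₁ k₂ (twinVertex v k₁ k₂ t) = v := by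
  unfold twinVertex twinBase
  split_ifs <;> simp

theorem twinPos_twinVertex (t : Fin (k₁ + k₂ + 1)) :
    twinPos k₁ k₂ (twinVertex v k₁ k₂ t) = t := by
  unfold twinVertex twinPos
  split_ifs <;> simp [Fin.ext_iff] <;> omega

theorem twinVertex_twinPos (y : V ⊕ (Fin k₁ ⊕ Fin k₂)) (hy : twinBase v k₁ k₂ y = v) :
    twinVertex v k₁ k₂ (twinPos k₁ k₂ y) = y := by
  rcases y with x | i | i
  · simp only [twinBase, Sum.elim_inl, id] at hy
    simp [twinVertex, twinPos, hy]
  · have e : twinPos k₁ k₂ (Sum.inr (Sum.inl i) : V ⊕ _) = ⟨k₁ - 1 - i, by omega⟩ := rfl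
    have h : k₁ - 1 - (i : ℕ) < k₁ := by omega
    rw [e, twinVertex, dif_pos h]
    congr 2
    simp only [Fin.ext_iff]
    omega
  · have e : twinPos k₁ k₂ (Sum.inr (Sum.inr i) : V ⊕ _) = ⟨k₁ + 1 + i, by omega⟩ := rfl
    have h1 : ¬ k₁ + 1 + (i : ℕ) < k₁ := by omega
    have h2 : ¬ k₁ + 1 + (i : ℕ) = k₁ := by omega
    rw [e, twinVertex, dif_neg h1, dif_neg h2]
    congr 2
    simp only [Fin.ext_iff]
    omega

theorem inl_twinBase (y : V ⊕ (Fin k₁ ⊕ Fin k₂)) (hy : twinPos k₁ k₂ y = ⟨k₁, by omega⟩) :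
    Sum.inl (twinBase v k₁ k₂ y) = y := by
  rcases y with x | i | i
  · rfl
  · simp [twinPos] at hy
    omega
  · simp [twinPos] at hy
    omega

/-- In the combined path `v` has position `k₁`, and the first path runs backwards from it to
position 0. -/
theorem firstPath_eq_twinVertex (a : Fin (k₁ + 1)) :
    firstPath v k₁ k₂ a = twinVertex v k₁ k₂ ⟨k₁ - a, by omega⟩ := by
  refine Fin.cases ?_ (fun i => ?_) a
  · simp [firstPath, twinVertex]
  · have : k₁ - ((i : ℕ) + 1) < k₁ := by omega
    simp only [firstPath, Function.Embedding.coeFn_mk, Fin.cons_succ, twinVertex, Fin.val_succ,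
      this, dif_pos]
    congr 2
    simp only [Fin.ext_iff]
    omega

theorem secondPath_eq_twinVertex (a : Fin (k₂ + 1)) :
    secondPath v k₁ k₂ a = twinVertex v k₁ k₂ ⟨k₁ + a, by omega⟩ := by
  refine Fin.cases ?_ (fun i => ?_) a
  · simp [secondPath, twinVertex]
  · have h1 : ¬ k₁ + ((i : ℕ) + 1) < k₁ := by omega
    have h2 : ¬ k₁ + ((i : ℕ) + 1) = k₁ := by omega
    simp only [secondPath, Function.Embedding.coeFn_mk, Fin.cons_succ, twinVertex, Fin.val_succ,
      h1, h2, dif_neg, not_false_eq_true]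
    congr 2
    simp only [Fin.ext_iff]
    omega

variable (G : SimpleGraph V)

/-- `twinVertex` as an embedding. -/
def twinPathEmbedding : Fin (k₁ + k₂ + 1) ↪ V ⊕ (Fin k₁ ⊕ Fin k₂) :=
  ⟨twinVertex v k₁ k₂, Function.LeftInverse.injective (twinPos_twinVertex v k₁ k₂)⟩

theorem twinPathEmbedding_apply (t : Fin (k₁ + k₂ + 1)) :
    twinPathEmbedding v k₁ k₂ t = twinVertex v k₁ k₂ t := rfl

theorem map_sup_edge {X Y : Type*} (F : SimpleGraph X) (f : X ↪ Y) (a b : X) :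
    (F ⊔ edge a b).map f = F.map f ⊔ edge (f a) (f b) := by
  ext y z
  simp only [map_adj, sup_adj, edge_adj]
  constructor
  · rintro ⟨y, z, h | ⟨⟨rfl, rfl⟩ | ⟨rfl, rfl⟩, h⟩, rfl, rfl⟩
    · exact Or.inl ⟨y, z, h, rfl, rfl⟩
    · exact Or.inr ⟨Or.inl ⟨rfl, rfl⟩, fun e => h (f.injective e)⟩
    · exact Or.inr ⟨Or.inr ⟨rfl, rfl⟩, fun e => h (f.injective e)⟩
  · rintro (⟨y, z, h, rfl, rfl⟩ | ⟨⟨rfl, rfl⟩ | ⟨rfl, rfl⟩, h⟩)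
    · exact ⟨y, z, Or.inl h, rfl, rfl⟩
    · exact ⟨a, b, Or.inr ⟨Or.inl ⟨rfl, rfl⟩, fun e => h (e ▸ rfl)⟩, rfl, rfl⟩
    · exact ⟨b, a, Or.inr ⟨Or.inr ⟨rfl, rfl⟩, fun e => h (e ▸ rfl)⟩, rfl, rfl⟩

theorem pathGraph_map_twinVertex :
    (pathGraph (k₁ + 1)).map (firstPath v k₁ k₂) ⊔ (pathGraph (k₂ + 1)).map (secondPath v k₁ k₂) =
      (pathGraph (k₁ + k₂ + 1)).map (twinPathEmbedding v k₁ k₂) := by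
  ext y z
  simp only [sup_adj, map_adj, pathGraph_adj, twinPathEmbedding_apply,
    firstPath_eq_twinVertex, secondPath_eq_twinVertex]
  constructor
  · rintro (⟨a, b, h, rfl, rfl⟩ | ⟨a, b, h, rfl, rfl⟩)
    · exact ⟨_, _, by simp; omega, rfl, rfl⟩
    · exact ⟨_, _, by simp; omega, rfl, rfl⟩
  · rintro ⟨a, b, h, rfl, rfl⟩
    -- Consecutive positions cannot straddle `k₁`: if one exceeds it, the other is at least `k₁`.
    by_cases hab : (a : ℕ) ≤ k₁ ∧ (b : ℕ) ≤ k₁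
    · refine Or.inl ⟨⟨k₁ - a, by omega⟩, ⟨k₁ - b, by omega⟩, by simp; omega, ?_, ?_⟩ <;>
        congr 1 <;> ext <;> simp <;> omega
    · refine Or.inr ⟨⟨a - k₁, by omega⟩, ⟨b - k₁, by omega⟩, by simp; omega, ?_, ?_⟩ <;>
        congr 1 <;> ext <;> simp <;> omega

theorem twinPathGraph_eq : G.twinPathGraph v k₁ k₂ = G.map Function.Embedding.inl ⊔
    (pathGraph (k₁ + k₂ + 1)).map (twinPathEmbedding v k₁ k₂) := by
  rw [twinPathGraph, sup_assoc, pathGraph_map_twinVertex]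

/-- The free ends have positions 0 and `k₁ + k₂`, so the inserted edge is the closing edge of the
combined path. -/
theorem closedTwinPathGraph_eq : G.closedTwinPathGraph v k₁ k₂ = G.map Function.Embedding.inl ⊔
    (closedPathGraph (k₁ + k₂)).map (twinPathEmbedding v k₁ k₂) := by
  rw [closedTwinPathGraph, twinPathGraph_eq, closedPathGraph, sup_assoc, map_sup_edge,
    firstPath_eq_twinVertex, secondPath_eq_twinVertex, twinPathEmbedding_apply,
    twinPathEmbedding_apply]
  congr 4
  simp

variable {G} in
theorem isOneSum_map_sup_map (N : SimpleGraph (Fin (k₁ + k₂ + 1))) :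
    IsOneSum G v N ⟨k₁, by omega⟩
      (G.map Function.Embedding.inl ⊔ N.map (twinPathEmbedding v k₁ k₂))
      Sum.inl (twinVertex v k₁ k₂) (twinBase v k₁ k₂) (twinPos k₁ k₂) where
  g_i x := rfl
  p_i x := rfl
  g_q := twinBase_twinVertex v k₁ k₂
  p_q := twinPos_twinVertex v k₁ k₂
  i_g := inl_twinBase v k₁ k₂
  q_p := twinVertex_twinPos v k₁ k₂
  cover y := by rcases y with x | i <;> simp [twinPos, twinBase]
  adj_iff y z := by
    rw [sup_adj, map_adj, map_adj]
    refine or_congr ⟨?_, ?_⟩ ⟨?_, ?_⟩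
    · rintro ⟨a, b, h, rfl, rfl⟩
      exact ⟨rfl, rfl, h⟩
    · rintro ⟨hy, hz, h⟩
      refine ⟨_, _, h, ?_, ?_⟩
      · exact inl_twinBase v k₁ k₂ y hy
      · exact inl_twinBase v k₁ k₂ z hz
    · rintro ⟨a, b, h, rfl, rfl⟩
      simpa only [twinPathEmbedding_apply, twinBase_twinVertex, twinPos_twinVertex, true_and]
    · rintro ⟨hy, hz, h⟩
      exact ⟨_, _, h, twinVertex_twinPos v k₁ k₂ y hy, twinVertex_twinPos v k₁ k₂ z hz⟩

end TwinPaths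

end SimpleGraph

/-! ### Closed formulas and comparison -/

namespace SimpleGraph

variable {V : Type*} [Fintype V] {G : SimpleGraph V}

theorem sum_degVec_eq (G : SimpleGraph V) : ∑ x, G.degVec x = 2 * G.numEdges := by
  classical
  have := G.sum_degrees_eq_twice_card_edges
  simp only [degVec, numEdges]
  rw [Set.ncard_eq_toFinset_card']
  exact_mod_cast this

omit [Fintype V] in
theorem twoForestMatrix_symm (G : SimpleGraph V) (i j : V) :
    G.twoForestMatrix i j = G.twoForestMatrix j i := by
  simp only [twoForestMatrix, reachable_comm]

theorem phi_eq (G : SimpleGraph V) (v : V) : G.phi v =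
    2 * (2 * G.numEdges) * ∑ x, G.degVec x * G.twoForestMatrix x v -
      ∑ x, ∑ y, G.degVec x * G.degVec y * G.twoForestMatrix x y := by
  rw [phi, Matrix.sub_mulVec, dotProduct_sub, ← sum_degVec_eq]
  simp only [dotProduct, Matrix.mulVec, Matrix.smul_apply, Matrix.vecMulVec_apply, Pi.one_apply,
    mul_one, smul_eq_mul, Finset.mul_sum, Finset.sum_mul]
  congr 1
  · refine Finset.sum_congr rfl fun x _ => Finset.sum_congr rfl fun y _ => by ring
  · refine Finset.sum_congr rfl fun x _ => Finset.sum_congr rfl fun y _ => by ring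

theorem IsOneSum.isKemenyConstant {P W : Type*} [Fintype P] [Fintype W] {v : V}
    {N : SimpleGraph P} {o : P} {H : SimpleGraph W} {i : V → W} {q : P → W} {g : W → V} {p : W → P}
    [Nontrivial W] (h : IsOneSum G v N o H i q g p) (hG : G.Connected) (hN : N.Connected)
    {S : P → P → ℝ} (hS : N.IsResistanceKernel S) (hS' : ∀ s t, S s t = S t s) :
    ∃ κ : ℝ≥0, IsKemenyConstant H.randomWalkMatrix κ ∧ (κ : ℝ) =
      ((∑ x, ∑ y, G.degVec x * G.degVec y * G.twoForestMatrix x y) / G.numSpanningTrees +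
        ∑ s, ∑ t, N.degVec s * N.degVec t * S s t +
        2 * ((∑ t, N.degVec t) *
          ((∑ x, G.degVec x * G.twoForestMatrix x v) / G.numSpanningTrees) +
          2 * G.numEdges * ∑ t, N.degVec t * S t o)) /
      (2 * (2 * G.numEdges + ∑ t, N.degVec t)) := by
  have hR := isResistanceKernel_twoForestMatrix hG
  obtain ⟨κ, h1, h2⟩ := (h.isResistanceKernel hR hS).isKemenyConstant (h.connected hG hN)
  refine ⟨κ, h1, ?_⟩
  have hK := h.sum_degVec_mul_degVec_mul
    (R := fun x y => G.twoForestMatrix x y / G.numSpanningTrees)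
    (fun x y => by rw [twoForestMatrix_symm]) (hR.1 v) hS' (hS.1 o)
  rw [h2, h.sum_degVec, hK, sum_degVec_eq G]
  simp only [Finset.sum_div, mul_div_assoc]

theorem _root_.IsKemenyConstant.unique {W : Type*} [Fintype W] [Nonempty W] {M : Matrix W W ℝ} {a b : ℝ≥0}
    (ha : IsKemenyConstant M a) (hb : IsKemenyConstant M b) : a = b := by
  obtain ⟨w, hw, -⟩ := ha.1
  have i : W := Classical.arbitrary W
  exact_mod_cast (ha.2 w hw i).symm.trans (hb.2 w hw i)

variable (v : V) (k₁ k₂ : ℕ)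

theorem exists_isKemenyConstant_twinPathGraph (hG : G.Connected) (hk : 2 ≤ k₁ + k₂) :
    ∃ κ : ℝ≥0, IsKemenyConstant (G.twinPathGraph v k₁ k₂).randomWalkMatrix κ ∧ (κ : ℝ) =
      ((∑ x, ∑ y, G.degVec x * G.degVec y * G.twoForestMatrix x y) / G.numSpanningTrees +
        2 * (k₁ + k₂) * (2 * (k₁ + k₂) ^ 2 + 1) / 3 +
        2 * (2 * (k₁ + k₂) *
          ((∑ x, G.degVec x * G.twoForestMatrix x v) / G.numSpanningTrees) +
          2 * G.numEdges * (k₁ ^ 2 + k₂ ^ 2))) / (2 * (2 * G.numEdges + 2 * (k₁ + k₂))) := by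
  have : Nontrivial (Fin (k₁ + k₂ + 1)) := Fin.nontrivial_iff_two_le.2 (by omega)
  have : Nontrivial (V ⊕ (Fin k₁ ⊕ Fin k₂)) := (twinPathEmbedding v k₁ k₂).injective.nontrivial
  obtain ⟨κ, h1, h2⟩ := (isOneSum_map_sup_map v k₁ k₂ (pathGraph (k₁ + k₂ + 1))).isKemenyConstant hG
    (pathGraph_connected _) (isResistanceKernel_pathGraph _) fun s t => abs_sub_comm _ _
  refine ⟨κ, by rwa [twinPathGraph_eq], ?_⟩
  rw [h2, sum_degVec_pathGraph, sum_degVec_pathGraph_mul_degVec_mul_abs]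
  simp only
  rw [sum_degVec_pathGraph_mul_abs (Nat.le_add_right k₁ k₂)]
  push_cast
  congr 1
  ring

theorem exists_isKemenyConstant_closedTwinPathGraph (hG : G.Connected) (hk : 2 ≤ k₁ + k₂) :
    ∃ κ : ℝ≥0, IsKemenyConstant (G.closedTwinPathGraph v k₁ k₂).randomWalkMatrix κ ∧ (κ : ℝ) =
      ((∑ x, ∑ y, G.degVec x * G.degVec y * G.twoForestMatrix x y) / G.numSpanningTrees +
        2 * (k₁ + k₂ + 1) * ((k₁ + k₂) * (k₁ + k₂ + 2)) / 3 +
        2 * (2 * (k₁ + k₂ + 1) *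
          ((∑ x, G.degVec x * G.twoForestMatrix x v) / G.numSpanningTrees) +
          2 * G.numEdges * ((k₁ + k₂) * (k₁ + k₂ + 2) / 3))) /
            (2 * (2 * G.numEdges + 2 * (k₁ + k₂ + 1))) := by
  have : Nontrivial (Fin (k₁ + k₂ + 1)) := Fin.nontrivial_iff_two_le.2 (by omega)
  have : Nontrivial (V ⊕ (Fin k₁ ⊕ Fin k₂)) := (twinPathEmbedding v k₁ k₂).injective.nontrivial
  obtain ⟨κ, h1, h2⟩ := (isOneSum_map_sup_map v k₁ k₂ (closedPathGraph (k₁ + k₂))).isKemenyConstant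
    hG ((pathGraph_connected _).mono le_sup_left) (isResistanceKernel_closedPathGraph hk)
    fun s t => by rw [abs_sub_comm]
  refine ⟨κ, by rwa [closedTwinPathGraph_eq], ?_⟩
  rw [h2, sum_degVec_closedPathGraph hk, sum_degVec_closedPathGraph_mul_degVec_mul hk]
  simp only
  rw [sum_degVec_closedPathGraph_mul hk (Nat.le_add_right k₁ k₂)]
  push_cast
  ring

/-- The factor clears the denominators `4 (m + k - 1)` and `4 (m + k)`, together with `τ`. The terms
in `𝐝ᵀ F 𝐝` and `𝐝ᵀ 𝐟ᵛ` then combine to `k φ_G(v)`, and what remains is a polynomial identity. -/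
theorem Phi_eq (hG : G.Connected) (hk : 2 ≤ k₁ + k₂) {a b : ℝ}
    (ha : a = ((∑ x, ∑ y, G.degVec x * G.degVec y * G.twoForestMatrix x y) / G.numSpanningTrees +
        2 * (k₁ + k₂) * (2 * (k₁ + k₂) ^ 2 + 1) / 3 +
        2 * (2 * (k₁ + k₂) *
          ((∑ x, G.degVec x * G.twoForestMatrix x v) / G.numSpanningTrees) +
          2 * G.numEdges * (k₁ ^ 2 + k₂ ^ 2))) / (2 * (2 * G.numEdges + 2 * (k₁ + k₂))))
    (hb : b = ((∑ x, ∑ y, G.degVec x * G.degVec y * G.twoForestMatrix x y) / G.numSpanningTrees +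
        2 * (k₁ + k₂ + 1) * ((k₁ + k₂) * (k₁ + k₂ + 2)) / 3 +
        2 * (2 * (k₁ + k₂ + 1) *
          ((∑ x, G.degVec x * G.twoForestMatrix x v) / G.numSpanningTrees) +
          2 * G.numEdges * ((k₁ + k₂) * (k₁ + k₂ + 2) / 3))) /
            (2 * (2 * G.numEdges + 2 * (k₁ + k₂ + 1)))) :
    G.Phi v k₁ k₂ = 4 * G.numSpanningTrees * (k₁ + k₂ + 1) * (G.numEdges + (k₁ + k₂)) *
      (G.numEdges + (k₁ + k₂ + 1)) * (b - a) := by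
  have hτ : (G.numSpanningTrees : ℝ) ≠ 0 := by exact_mod_cast (numSpanningTrees_pos hG).ne'
  have hs : (2 : ℝ) ≤ k₁ + k₂ := by exact_mod_cast hk
  have hm : (0 : ℝ) ≤ G.numEdges := Nat.cast_nonneg _
  simp only [Phi, phi_eq, phi₁, phi₂, phi₃]
  subst ha hb
  generalize (∑ x, ∑ y, G.degVec x * G.degVec y * G.twoForestMatrix x y) = K
  generalize (∑ x, G.degVec x * G.twoForestMatrix x v) = ρ
  generalize (G.numSpanningTrees : ℝ) = τ at *
  generalize (G.numEdges : ℝ) = m at *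
  generalize (k₁ : ℝ) = x at *
  generalize (k₂ : ℝ) = y at *
  have h1 : m + (x + y) ≠ 0 := by linarith
  have h2 : m + (x + y + 1) ≠ 0 := by linarith
  rw [show 2 * (2 * m + 2 * (x + y)) = 4 * (m + (x + y)) by ring,
    show 2 * (2 * m + 2 * (x + y + 1)) = 4 * (m + (x + y + 1)) by ring]
  field_simp
  ring

end SimpleGraph

theorem theorem3p1 {V : Type*} [Fintype V] (G : SimpleGraph V) (hG : G.Connected) (v : V)
    (k₁ k₂ : ℕ) (hk : 2 ≤ k₁ + k₂) :
    -- Kemeny's constants of both random walks are well defined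
    (∃ a : ℝ≥0, IsKemenyConstant (G.twinPathGraph v k₁ k₂).randomWalkMatrix a) ∧
    (∃ b : ℝ≥0, IsKemenyConstant (G.closedTwinPathGraph v k₁ k₂).randomWalkMatrix b) ∧
    (G.IsParadoxical v k₁ k₂ ↔ G.Phi v k₁ k₂ > 0) := by
  obtain ⟨a, ha, ha'⟩ := SimpleGraph.exists_isKemenyConstant_twinPathGraph v k₁ k₂ hG hk
  obtain ⟨b, hb, hb'⟩ := SimpleGraph.exists_isKemenyConstant_closedTwinPathGraph v k₁ k₂ hG hk
  refine ⟨⟨a, ha⟩, ⟨b, hb⟩, ?_⟩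
  have hΦ := SimpleGraph.Phi_eq v k₁ k₂ hG hk ha' hb'
  have hτ : (0 : ℝ) < G.numSpanningTrees := by exact_mod_cast SimpleGraph.numSpanningTrees_pos hG
  have hs : (2 : ℝ) ≤ k₁ + k₂ := by exact_mod_cast hk
  have hpos : (0 : ℝ) < 4 * G.numSpanningTrees * (k₁ + k₂ + 1) * (G.numEdges + (k₁ + k₂)) *
      (G.numEdges + (k₁ + k₂ + 1)) := by positivity
  rw [hΦ, gt_iff_lt, mul_pos_iff_of_pos_left hpos, sub_pos, NNReal.coe_lt_coe]
  have : Nonempty V := ⟨v⟩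
  constructor
  -- `IsParadoxical` supplies some pair of constants; uniqueness identifies it with the computed
  -- one.
  · rintro ⟨a', b', h1, h2, h⟩
    rwa [ha.unique h1, hb.unique h2]
  · exact fun h => ⟨a, b, ha, hb, h⟩
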